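/- Let $n\ge 1$. A closed convex set $K\subseteq\mathbb{R}^n$ is called lattice-free if its topological interior contains no point of $\mathbb{Z}^n$; it is a maximal lattice-free convex set if, in addition, it is not properly contained in any lattice-free closed convex set. A linear subspace $L\subseteq\mathbb{R}^n$ is a lattice subspace if $\dim(L\cap\mathbb{Z}^n)=\dim(L)$, i.e. if $L$ is linearly spanned by integer vectors. A polyhedron is the solution set of finitely many linear inequalities, a polytope is a bounded polyhedron, the dimension of a set is the dimension of its affine hull, and a facet of a polyhedron $K$ is a nonempty face of $K$ of dimension $\dim(K)-1$. Theorem. A set $K\subseteq\mathbb{R}^n$ is a maximal lattice-free convex set if and only if one of the following conditions holds: (a) $K=a+L$, where $a\in\mathbb{R}^n$ and $L$ is a linear subspace of $\mathbb{R}^n$ of dimension $n-1$ that is not a lattice subspace; (b) $K$ is an $n$-dimensional polyhedron with $\operatorname{int}(K)\cap\mathbb{Z}^n=\emptyset$, of the form $K=Q+L$, where $L$ is a lattice subspace of dimension $r$ with $r<n$, $Q$ is a polytope of dimension $n-r$, and the relative interior of every facet of $K$ contains an integer point. -/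

import Mathlib

open scoped Pointwise

/-- The set `ℤⁿ` of integer points of `ℝⁿ`. -/
def integerPoints (n : ℕ) : Set (EuclideanSpace ℝ (Fin n)) :=
  {x | ∀ i, ∃ m : ℤ, x i = (m : ℝ)}

/-- A closed convex set `K ⊆ ℝⁿ` is `S`-free if no point of `S` lies in its (topological)
interior. -/
structure IsFree {n : ℕ} (S K : Set (EuclideanSpace ℝ (Fin n))) : Prop where
  isClosed : IsClosed K
  convex : Convex ℝ K
  interior_inter : interior K ∩ S = ∅

/-- Lattice-free convex sets: the `ℤⁿ`-free ones. -/
def IsLatticeFree {n : ℕ} (K : Set (EuclideanSpace ℝ (Fin n))) : Prop :=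
  IsFree (integerPoints n) K

/-- A maximal lattice-free convex set: lattice-free, and not properly contained in any lattice-free
convex set. -/
def IsMaximalLatticeFree {n : ℕ} (K : Set (EuclideanSpace ℝ (Fin n))) : Prop :=
  Maximal IsLatticeFree K

/-- The dimension of a set is the dimension of its affine hull (the value at `∅` is `0`). -/
noncomputable def setDim {n : ℕ} (K : Set (EuclideanSpace ℝ (Fin n))) : ℕ :=
  Module.finrank ℝ (vectorSpan ℝ K)

/-- A linear subspace `L` of `ℝⁿ` is a lattice subspace if `dim (L ∩ ℤⁿ) = dim L`, the dimension of
the lattice `L ∩ ℤⁿ` being that of its linear span. -/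
def IsLatticeSubspace {n : ℕ} (L : Submodule ℝ (EuclideanSpace ℝ (Fin n))) : Prop :=
  Module.finrank ℝ (Submodule.span ℝ ((L : Set (EuclideanSpace ℝ (Fin n))) ∩ integerPoints n)) =
    Module.finrank ℝ L

/-- A polyhedron is the solution set of a finite system of linear inequalities. -/
def IsPolyhedron {n : ℕ} (K : Set (EuclideanSpace ℝ (Fin n))) : Prop :=
  ∃ (m : ℕ) (a : Fin m → EuclideanSpace ℝ (Fin n)) (b : Fin m → ℝ),
    K = {x | ∀ i, inner ℝ (a i) x ≤ b i}

/-- A polytope is a bounded polyhedron. -/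
def IsPolytope {n : ℕ} (Q : Set (EuclideanSpace ℝ (Fin n))) : Prop :=
  IsPolyhedron Q ∧ Bornology.IsBounded Q

/-- `F` is a facet of `K`: a nonempty face of `K` (the set of maximizers over `K` of a linear
functional) of dimension `dim K - 1`. -/
structure IsFacet {n : ℕ} (K F : Set (EuclideanSpace ℝ (Fin n))) : Prop where
  nonempty : F.Nonempty
  isExposed : IsExposed ℝ K F
  dim_add_one : setDim F + 1 = setDim K

/-!
A set with property (b) is maximal for a local reason. A point outside a full-dimensional polyhedron
lies strictly beyond some facet (`IsPolyhedron.exists_facet_lt`), and a supporting hyperplane of a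
larger lattice-free set at an integer point in the relative interior of this facet would have to be
the hyperplane of the facet, with points of the larger set strictly on both sides
(`IsPolyhedron.isMaximalLatticeFree`). For (a), a linear functional takes a dense set of values on
`ℤⁿ` unless its kernel is a lattice subspace, so every slab next to the hyperplane contains integer
points (`isMaximalLatticeFree_hyperplane`).

Conversely, a maximal lattice-free set without interior points is a hyperplane; were its direction a
lattice subspace, a determinant would give an integral functional vanishing on it, and the slab
between two consecutive integer levels would be a larger lattice-free set
(`IsMaximalLatticeFree.exists_eq_vadd`).

The main case is a maximal lattice-free set `K` with interior points. Let `L` be its lineality space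
and `P` the orthogonal projection onto the complement of `L`. If the multiples of a vector `w` are
approximated by sums of integer points and recession directions of `K`, then the closure of `K + ℝ w`
is lattice-free, so that `w ∈ L` (`IsMaximalLatticeFree.mem_linealitySpace`). This criterion is
applied twice. By Dirichlet approximation it shows that all recession directions lie in `L`, so that
`K` is bounded modulo `L`; and it shows that `P ℤⁿ` is discrete, since a limit direction of small
vectors of `P ℤⁿ` would lie in `L`. Discreteness implies that `L` is a lattice subspace and that only
finitely many integer points, modulo `L`, are near `K`. Therefore finitely many half-spaces suffice
to separate `K` from the integer points nearby, and by maximality `K` is the polyhedron that they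
define together with a box (`IsMaximalLatticeFree.isPolyhedron`). By the same finiteness, a facet
inequality without an integer point in the relative interior of its facet could be relaxed
(`IsMaximalLatticeFree.exists_integer_mem_intrinsicInterior`).
-/

/-! ### Linear functionals on convex sets -/

section Convexity

open Filter Topology

variable {E : Type*} [NormedAddCommGroup E] [NormedSpace ℝ E]

/-- A linear functional whose maximum over `s` is attained at an interior point of `s` vanishes. -/
lemma eq_zero_of_mem_interior_of_forall_le {s : Set E} {f : StrongDual ℝ E} {z : E}
    (hz : z ∈ interior s) (h : ∀ x ∈ s, f x ≤ f z) : f = 0 := by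
  have key : ∀ v, f v ≤ 0 := by
    intro v
    have hc : Tendsto (fun t : ℝ => z + t • v) (𝓝[>] 0) (𝓝 z) := by
      have : Continuous fun t : ℝ => z + t • v := by fun_prop
      simpa using (this.tendsto 0).mono_left nhdsWithin_le_nhds
    obtain ⟨t, hts, ht⟩ := ((hc.eventually (mem_interior_iff_mem_nhds.1 hz)).and
      self_mem_nhdsWithin).exists
    have := h _ hts
    simp only [map_add, map_smul, smul_eq_mul] at this
    have ht : (0 : ℝ) < t := ht
    nlinarith
  ext v
  have h1 := key v
  have h2 := key (-v)
  simp only [map_neg] at h2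
  exact le_antisymm h1 (neg_nonpos.1 h2)

/-- A linear functional whose maximum over `s` is attained at a point of the relative interior is
constant on `s`. -/
lemma eq_of_mem_intrinsicInterior_of_forall_le {s : Set E} {f : StrongDual ℝ E} {z : E}
    (hz : z ∈ intrinsicInterior ℝ s) (h : ∀ x ∈ s, f x ≤ f z) {x : E} (hx : x ∈ s) :
    f x = f z := by
  obtain ⟨y, hy, rfl⟩ := mem_intrinsicInterior.1 hz
  refine le_antisymm (h x hx) ?_
  -- move from `z` slightly away from `x`, inside the affine hull
  let φ : ℝ → affineSpan ℝ s := fun t =>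
    ⟨AffineMap.lineMap (y : E) x t, AffineMap.lineMap_mem t y.2 (subset_affineSpan ℝ s hx)⟩
  have hφ : Continuous φ := by
    refine Continuous.subtype_mk ?_ _
    exact AffineMap.lineMap_continuous
  have hc : Tendsto φ (𝓝[<] 0) (𝓝 y) := by
    have h0 : φ 0 = y := Subtype.ext (by simp [φ])
    simpa [h0] using (hφ.tendsto 0).mono_left nhdsWithin_le_nhds
  obtain ⟨t, hts, ht⟩ := ((hc.eventually (mem_interior_iff_mem_nhds.1 hy)).and
      self_mem_nhdsWithin).exists
  have ht : t < (0 : ℝ) := ht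
  have := h _ hts
  simp only [φ, AffineMap.lineMap_apply, vsub_eq_sub, vadd_eq_add, map_add, map_smul, map_sub,
    smul_eq_mul] at this
  nlinarith

/-- If an open set meets the affine hull of `s` only in points of `s`, its points in the affine hull
are relative interior points of `s`. -/
lemma mem_intrinsicInterior_of_isOpen {s U : Set E} {z : E} (hU : IsOpen U) (hzU : z ∈ U)
    (hz : z ∈ affineSpan ℝ s) (h : ∀ x ∈ U, x ∈ affineSpan ℝ s → x ∈ s) :
    z ∈ intrinsicInterior ℝ s := by
  refine mem_intrinsicInterior.2 ⟨⟨z, hz⟩, ?_, rfl⟩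
  refine mem_interior.2 ⟨((↑) : affineSpan ℝ s → E) ⁻¹' U, ?_, hU.preimage continuous_subtype_val,
    hzU⟩
  exact fun x hx => h x hx x.2

/-- A functional vanishing on the kernel of `f` is a multiple of `f`. -/
lemma exists_eq_mul_of_ker_le {f g : StrongDual ℝ E} (hf : f ≠ 0)
    (h : ∀ x, f x = 0 → g x = 0) : ∃ c : ℝ, ∀ x, g x = c * f x := by
  obtain ⟨e, he⟩ : ∃ e, f e ≠ 0 := by
    by_contra! hc
    exact hf (ContinuousLinearMap.ext hc)
  refine ⟨g e / f e, fun x => ?_⟩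
  have := h (x - (f x / f e) • e) (by simp [he])
  simp only [map_sub, map_smul, smul_eq_mul] at this
  field_simp at this ⊢
  linarith

/-- A point outside the interior of a convex set with nonempty interior is weakly separated from
the set. -/
lemma Convex.exists_forall_le_of_notMem_interior {s : Set E} (hs : Convex ℝ s)
    (hne : (interior s).Nonempty) {z : E} (hz : z ∉ interior s) :
    ∃ f : StrongDual ℝ E, f ≠ 0 ∧ ∀ x ∈ s, f x ≤ f z := by
  obtain ⟨f, hf⟩ := geometric_hahn_banach_open_point hs.interior isOpen_interior hz
  refine ⟨f, ?_, fun x hx => ?_⟩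
  · rintro rfl
    obtain ⟨y, hy⟩ := hne
    simpa using hf y hy
  · have hx' : x ∈ closure (interior s) := by
      rw [hs.closure_interior_eq_closure_of_nonempty_interior hne]
      exact subset_closure hx
    exact closure_minimal (fun y hy => (hf y hy).le) (isClosed_le f.continuous continuous_const) hx'

lemma interior_setOf_apply_eq {f : StrongDual ℝ E} (hf : f ≠ 0) (b : ℝ) :
    interior {x | f x = b} = ∅ := by
  by_contra hne
  obtain ⟨z, hz⟩ := Set.nonempty_iff_ne_empty.2 hne
  refine hf (eq_zero_of_mem_interior_of_forall_le hz fun x hx => ?_)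
  have hz' : z ∈ {x | f x = b} := interior_subset hz
  exact (show f x = b from hx).le.trans (show f z = b from hz').ge

lemma interior_setOf_apply_mem_Icc_subset {f : StrongDual ℝ E} (hf : f ≠ 0) (a b : ℝ) :
    interior {x | f x ∈ Set.Icc a b} ⊆ {x | f x ∈ Set.Ioo a b} := by
  intro z hz
  have hz' : f z ∈ Set.Icc a b := (interior_subset hz : _)
  refine ⟨lt_of_le_of_ne hz'.1 fun h => ?_, lt_of_le_of_ne hz'.2 fun h => ?_⟩
  · refine neg_ne_zero.2 hf (eq_zero_of_mem_interior_of_forall_le hz fun x hx => ?_)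
    simpa [← h] using hx.1
  · exact hf (eq_zero_of_mem_interior_of_forall_le hz fun x hx => h ▸ hx.2)

lemma convex_setOf_apply_mem {f : StrongDual ℝ E} {s : Set ℝ} (hs : Convex ℝ s) :
    Convex ℝ {x | f x ∈ s} := hs.linear_preimage f.toLinearMap

lemma Convex.exists_mem_interior_of_mem_interior_add_submodule {K : Set E} (hK : Convex ℝ K)
    (hne : (interior K).Nonempty) (L : Submodule ℝ E) {z : E}
    (hz : z ∈ interior (K + (L : Set E))) : ∃ v ∈ L, z - v ∈ interior K := by
  obtain ⟨y, hy⟩ := hne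
  -- push `z` away from `y` inside `K + L`, then come back
  have hc : Tendsto (fun t : ℝ => z + t • (z - y)) (𝓝[>] 0) (𝓝 z) := by
    have : Continuous fun t : ℝ => z + t • (z - y) := by fun_prop
    simpa using (this.tendsto 0).mono_left nhdsWithin_le_nhds
  obtain ⟨t, hts, ht⟩ := ((hc.eventually (mem_interior_iff_mem_nhds.1 hz)).and
    self_mem_nhdsWithin).exists
  have ht : (0 : ℝ) < t := ht
  obtain ⟨k, hk, l, hl, hkl⟩ := Set.mem_add.1 hts
  have h1 : (0 : ℝ) < 1 + t := by linarith
  refine ⟨(1 / (1 + t)) • l, L.smul_mem _ hl, ?_⟩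
  have h2 := hK.combo_self_interior_mem_interior hk hy (a := 1 / (1 + t)) (b := t / (1 + t))
    (by positivity) (by positivity) (by field_simp)
  convert h2 using 1
  have : k = z + t • (z - y) - l := by rw [← hkl]; abel
  rw [this]
  have e : z = (1 / (1 + t)) • ((1 + t) • z) := by
    rw [smul_smul, one_div_mul_cancel h1.ne', one_smul]
  nth_rw 1 [e]
  module

end Convexity

/-! ### Facets of full-dimensional polyhedra -/

section Facets

variable {n : ℕ}

local notation "𝔼" => EuclideanSpace ℝ (Fin n)

lemma setDim_eq_of_interior_nonempty {K : Set 𝔼} (hK : (interior K).Nonempty) : setDim K = n := by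
  have h : affineSpan ℝ K = ⊤ := affineSpan_eq_top_of_nonempty_interior
    (hK.mono (interior_mono (subset_convexHull ℝ K)))
  have h2 : vectorSpan ℝ K = ⊤ := by
    rw [← direction_affineSpan, h, AffineSubspace.direction_top]
  rw [setDim, h2, finrank_top, finrank_euclideanSpace_fin]

lemma interior_nonempty_of_setDim_eq (hn : 1 ≤ n) {K : Set 𝔼} (hc : Convex ℝ K)
    (hK : setDim K = n) : (interior K).Nonempty := by
  have hs : vectorSpan ℝ K = ⊤ := Submodule.eq_top_of_finrank_eq (by simpa [setDim] using hK)
  have hne : K.Nonempty := by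
    by_contra h
    rw [Set.not_nonempty_iff_eq_empty] at h
    rw [setDim, h, vectorSpan_empty, finrank_bot] at hK
    omega
  rw [hc.interior_nonempty_iff_affineSpan_eq_top]
  exact (AffineSubspace.affineSpan_eq_top_iff_vectorSpan_eq_top_of_nonempty _ _ _ hne).2 hs

lemma finrank_ker_add_one {f : StrongDual ℝ 𝔼} (hf : f ≠ 0) :
    Module.finrank ℝ f.ker + 1 = n := by
  have := Module.Dual.finrank_ker_add_one_of_ne_zero (f := f.toLinearMap)
    (fun h => hf (ContinuousLinearMap.coe_injective h))
  rwa [finrank_euclideanSpace_fin] at this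

lemma vectorSpan_le_ker {F : Set 𝔼} {f : StrongDual ℝ 𝔼} {b : ℝ} (h : ∀ x ∈ F, f x = b) :
    vectorSpan ℝ F ≤ f.ker := by
  rw [vectorSpan_def, Submodule.span_le]
  rintro _ ⟨x, hx, y, hy, rfl⟩
  simp [h x hx, h y hy]

/-- A facet of a full-dimensional set is cut out by a supporting hyperplane, which is its affine
hull. -/
lemma IsFacet.exists_functional {K F : Set 𝔼} (hF : IsFacet K F) (hK : setDim K = n) :
    ∃ (f : StrongDual ℝ 𝔼) (b : ℝ), f ≠ 0 ∧ (∀ x ∈ K, f x ≤ b) ∧ F = {x ∈ K | f x = b} ∧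
      ∀ x, f x = b ↔ x ∈ affineSpan ℝ F := by
  obtain ⟨f, hf⟩ := hF.isExposed hF.nonempty
  obtain ⟨p, hp⟩ := hF.nonempty
  have hpK : p ∈ K ∧ ∀ y ∈ K, f y ≤ f p := by rw [hf] at hp; exact hp
  have hF' : F = {x ∈ K | f x = f p} := by
    rw [hf]
    ext x
    constructor
    · rintro ⟨h1, h2⟩
      exact ⟨h1, le_antisymm (hpK.2 x h1) (h2 p hpK.1)⟩
    · rintro ⟨h1, h2⟩
      exact ⟨h1, fun y hy => (hpK.2 y hy).trans h2.ge⟩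
  have hf0 : f ≠ 0 := by
    rintro rfl
    have : F = K := by rw [hF']; simp
    have h1 := hF.dim_add_one
    rw [this] at h1
    omega
  have hle : ∀ x ∈ F, f x = f p := fun x hx => by rw [hF'] at hx; exact hx.2
  have hker : vectorSpan ℝ F = f.ker := by
    refine Submodule.eq_of_le_of_finrank_eq (vectorSpan_le_ker hle) ?_
    have h1 := finrank_ker_add_one hf0
    have h2 := hF.dim_add_one
    rw [setDim] at h2
    omega
  refine ⟨f, f p, hf0, hpK.2, hF', fun x => ?_⟩
  rw [← AffineSubspace.vsub_right_mem_direction_iff_mem (mem_affineSpan ℝ hp), direction_affineSpan,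
    hker]
  simp [sub_eq_zero]

/-- A point outside a full-dimensional polyhedron lies strictly beyond one of its facets. -/
lemma IsPolyhedron.exists_facet_lt {K : Set 𝔼} (hK : IsPolyhedron K) (hi : (interior K).Nonempty)
    {x : 𝔼} (hx : x ∉ K) : ∃ (F : Set 𝔼) (f : StrongDual ℝ 𝔼) (b : ℝ), IsFacet K F ∧
      F ⊆ K ∧ (∀ y, f y = b → y ∈ affineSpan ℝ F) ∧ (∀ y ∈ F, f y = b) ∧ (∀ y ∈ K, f y ≤ b) ∧
      b < f x := by
  classical
  obtain ⟨m, a, b, rfl⟩ := hK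
  set K : Set 𝔼 := {x | ∀ i, inner ℝ (a i) x ≤ b i} with hKdef
  -- an inclusion-minimal subsystem defining the same polyhedron
  obtain ⟨I, hI, hmin⟩ := (wellFounded_lt (α := Finset (Fin m))).has_min
    {I | ∀ x, (∀ i ∈ I, inner ℝ (a i) x ≤ b i) → x ∈ K} ⟨Finset.univ, by simp [hKdef]⟩
  obtain ⟨i, hiI, hix⟩ : ∃ i ∈ I, b i < inner ℝ (a i) x := by
    by_contra! h
    exact hx (hI x h)
  obtain ⟨x', hx', hx'K⟩ : ∃ x', (∀ j ∈ I.erase i, inner ℝ (a j) x' ≤ b j) ∧ x' ∉ K := by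
    have := hmin (I.erase i)
    by_contra! h
    exact this h (Finset.erase_ssubset hiI)
  have hix' : b i < inner ℝ (a i) x' := by
    by_contra! h
    refine hx'K (hI x' fun j hj => ?_)
    by_cases hji : j = i
    · exact hji ▸ h
    · exact hx' j (Finset.mem_erase.2 ⟨hji, hj⟩)
  obtain ⟨y, hy⟩ := hi
  have hyK : y ∈ K := interior_subset hy
  set f : StrongDual ℝ 𝔼 := innerSL ℝ (a i) with hfdef
  have hfa : ∀ z, f z = inner ℝ (a i) z := fun z => rfl
  have hfK : ∀ z ∈ K, f z ≤ b i := fun z hz => hz i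
  have hf0 : f ≠ 0 := by
    intro h
    have h1 := hyK i
    rw [← hfa, h] at h1 hix'
    simp only [zero_apply] at h1 hix'
    linarith
  have hyi : f y < b i := by
    refine lt_of_le_of_ne (hfK y hyK) fun h => hf0 (eq_zero_of_mem_interior_of_forall_le hy ?_)
    rw [h]
    exact hfK
  -- the point of `[y, x']` on the hyperplane
  obtain ⟨t, ht0, ht1, ht⟩ : ∃ t : ℝ, 0 < t ∧ t < 1 ∧ f y + t * (f x' - f y) = b i := by
    have h1 : 0 < f x' - f y := by rw [hfa x']; linarith
    refine ⟨(b i - f y) / (f x' - f y), div_pos (by linarith) h1, ?_, by field_simp; ring⟩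
    rw [div_lt_one h1, hfa x']
    linarith
  set p : 𝔼 := y + t • (x' - y) with hp
  have hfp : f p = b i := by simpa [hp] using ht
  set F : Set 𝔼 := {z ∈ K | f z = b i} with hF
  -- a convex combination of `x'` with a point of `K` satisfies the other inequalities of `I`
  have hnear : ∀ w, f w = 0 → y + (1 / (1 - t)) • w ∈ K → p + w ∈ F := by
    intro w hw hwK
    have h1t : 0 < 1 - t := by linarith
    refine ⟨hI _ fun j hj => ?_, by rw [map_add, hfp, hw, add_zero]⟩
    by_cases hji : j = i
    · rw [hji, ← hfa, map_add, hfp, hw, add_zero]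
    · have e : p + w = (1 - t) • (y + (1 / (1 - t)) • w) + t • x' := by
        rw [smul_add, smul_smul, mul_one_div_cancel h1t.ne', hp]
        module
      have h1 := hwK j
      have h2 := hx' j (Finset.mem_erase.2 ⟨hji, hj⟩)
      rw [e, inner_add_right, inner_smul_right, inner_smul_right]
      nlinarith
  have hpF : p ∈ F := by simpa using hnear 0 (by simp) (by simpa using hyK)
  have hker : vectorSpan ℝ F = f.ker := by
    refine le_antisymm (vectorSpan_le_ker fun x hx => hx.2) fun w hw => ?_
    have hw : f w = 0 := hw
    have hc : Filter.Tendsto (fun s : ℝ => y + (1 / (1 - t)) • s • w)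
        (nhdsWithin 0 (Set.Ioi 0)) (nhds y) := by
      have : Continuous fun s : ℝ => y + (1 / (1 - t)) • s • w := by fun_prop
      simpa using (this.tendsto 0).mono_left nhdsWithin_le_nhds
    obtain ⟨s, hsK, hs⟩ := ((hc.eventually (mem_interior_iff_mem_nhds.1 hy)).and
      self_mem_nhdsWithin).exists
    have hs : (0 : ℝ) < s := hs
    have h1 := vsub_mem_vectorSpan ℝ (hnear (s • w) (by simp [hw]) hsK) hpF
    rw [vsub_eq_sub, add_sub_cancel_left] at h1
    exact ((vectorSpan ℝ F).smul_mem_iff hs.ne').1 h1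
  refine ⟨F, f, b i, ⟨⟨p, hpF⟩, fun _ => ⟨f, ?_⟩, ?_⟩, fun z hz => hz.1, fun z hz => ?_,
    fun z hz => hz.2, hfK, hix⟩
  · ext z
    constructor
    · rintro ⟨h1, h2⟩
      exact ⟨h1, fun v hv => (hfK v hv).trans h2.ge⟩
    · rintro ⟨h1, h2⟩
      exact ⟨h1, le_antisymm (hfK z h1) (hfp ▸ h2 p hpF.1)⟩
  · rw [setDim_eq_of_interior_nonempty ⟨y, hy⟩, setDim, hker, finrank_ker_add_one hf0]
  · rw [← AffineSubspace.vsub_right_mem_direction_iff_mem (mem_affineSpan ℝ hpF),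
      direction_affineSpan, hker]
    simp [hz, hfp]

lemma IsPolyhedron.isClosed {K : Set 𝔼} (hK : IsPolyhedron K) : IsClosed K := by
  obtain ⟨m, a, b, rfl⟩ := hK
  simp only [Set.ofPred_forall]
  exact isClosed_iInter fun i => isClosed_le (by fun_prop) continuous_const

lemma IsPolyhedron.convex {K : Set 𝔼} (hK : IsPolyhedron K) : Convex ℝ K := by
  obtain ⟨m, a, b, rfl⟩ := hK
  simp only [Set.ofPred_forall]
  exact convex_iInter fun i => convex_halfSpace_le (innerSL ℝ (a i)).toLinearMap.isLinear (b i)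

/-- A full-dimensional lattice-free polyhedron all of whose facets have an integer point in the
relative interior is maximal: a supporting hyperplane of a larger lattice-free set at such a point
would have to contain the facet, and hence could not leave room for points beyond the facet. -/
lemma IsPolyhedron.isMaximalLatticeFree {K : Set 𝔼} (hK : IsPolyhedron K)
    (hi : (interior K).Nonempty) (hfree : interior K ∩ integerPoints n = ∅)
    (hF : ∀ F, IsFacet K F → (intrinsicInterior ℝ F ∩ integerPoints n).Nonempty) :
    IsMaximalLatticeFree K := by
  refine ⟨⟨hK.isClosed, hK.convex, hfree⟩, fun K' hK' hKK' x hx => ?_⟩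
  by_contra hxK
  obtain ⟨F, f, b, hFac, hFK, hspan, hFb, hKb, hbx⟩ := hK.exists_facet_lt hi hxK
  obtain ⟨z, hzF, hzZ⟩ := hF F hFac
  have hzF' : z ∈ F := intrinsicInterior_subset hzF
  have hz : z ∉ interior K' := fun h => by
    have : z ∈ interior K' ∩ integerPoints n := ⟨h, hzZ⟩
    rw [hK'.interior_inter] at this
    exact this
  obtain ⟨g, hg0, hg⟩ := hK'.convex.exists_forall_le_of_notMem_interior
    (hi.mono (interior_mono hKK')) hz
  have hgF : ∀ y ∈ F, g y = g z := fun y hy =>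
    eq_of_mem_intrinsicInterior_of_forall_le hzF (fun v hv => hg v (hKK' (hFK hv))) hy
  have hfz : f z = b := hFb z hzF'
  have hf0 : f ≠ 0 := by
    rintro rfl
    simp at hfz hbx
    linarith
  have hgspan : ∀ y ∈ affineSpan ℝ F, g y = g z := by
    intro y hy
    have h1 := AffineSubspace.vsub_mem_direction hy (mem_affineSpan ℝ hzF')
    rw [direction_affineSpan] at h1
    have h2 : g (y - z) = 0 := vectorSpan_le_ker hgF h1
    rw [map_sub] at h2
    linarith
  obtain ⟨c, hc⟩ := exists_eq_mul_of_ker_le hf0 (g := g) fun w hw => by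
    have := hgspan (z + w) (hspan _ (by rw [map_add, hfz, hw, add_zero]))
    rw [map_add] at this
    linarith
  obtain ⟨y, hy⟩ := hi
  have hy' : f y < b := by
    refine lt_of_le_of_ne (hKb y (interior_subset hy)) fun h =>
      hf0 (eq_zero_of_mem_interior_of_forall_le hy ?_)
    rw [h]
    exact hKb
  -- `g = c • f` must satisfy `c ≤ 0` because of `x`, and `0 ≤ c` because of `y`
  have h1 := hg x hx
  have h2 := hg y (hKK' (interior_subset hy))
  rw [hc, hc z, hfz] at h1 h2
  have hc0 : c = 0 := by
    apply le_antisymm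
    · by_contra! h
      nlinarith
    · by_contra! h
      nlinarith
  exact hg0 (ContinuousLinearMap.ext fun v => by rw [hc, hc0, zero_mul]; rfl)

end Facets

/-! ### Integer points and hyperplanes -/

section IntegerPoints

variable {n : ℕ}

local notation "𝔼" => EuclideanSpace ℝ (Fin n)

/-- The integer points as an additive subgroup. -/
def integerLattice (n : ℕ) : AddSubgroup (EuclideanSpace ℝ (Fin n)) where
  carrier := integerPoints n
  add_mem' := fun {x y} hx hy i => by
    obtain ⟨a, ha⟩ := hx i
    obtain ⟨b, hb⟩ := hy i
    exact ⟨a + b, by simp [ha, hb]⟩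
  zero_mem' := fun i => ⟨0, by simp⟩
  neg_mem' := fun {x} hx i => by
    obtain ⟨a, ha⟩ := hx i
    exact ⟨-a, by simp [ha]⟩

lemma single_mem_integerLattice (i : Fin n) :
    EuclideanSpace.single i (1 : ℝ) ∈ integerLattice n := fun j => by
  by_cases h : j = i
  · exact ⟨1, by simp [h]⟩
  · exact ⟨0, by simp [h]⟩

lemma IsLatticeFree.notMem_interior {K : Set 𝔼} (hK : IsLatticeFree K) {z : 𝔼}
    (hz : z ∈ integerLattice n) : z ∉ interior K := fun h => by
  have : z ∈ interior K ∩ integerPoints n := ⟨h, hz⟩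
  rw [hK.interior_inter] at this
  exact this

lemma isLatticeSubspace_iff {L : Submodule ℝ 𝔼} :
    IsLatticeSubspace L ↔ L ≤ Submodule.span ℝ ((L : Set 𝔼) ∩ integerPoints n) := by
  have hle : Submodule.span ℝ ((L : Set 𝔼) ∩ integerPoints n) ≤ L :=
    Submodule.span_le.2 Set.inter_subset_left
  exact ⟨fun h => (Submodule.eq_of_le_of_finrank_eq hle h).ge,
    fun h => by rw [IsLatticeSubspace, le_antisymm hle h]⟩

lemma exists_eq_ker_of_finrank (hn : 1 ≤ n) {L : Submodule ℝ 𝔼}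
    (hL : Module.finrank ℝ L = n - 1) : ∃ f : StrongDual ℝ 𝔼, f ≠ 0 ∧ L = f.ker := by
  have hlt : L < ⊤ := by
    refine lt_top_iff_ne_top.2 fun h => ?_
    rw [h, finrank_top, finrank_euclideanSpace_fin] at hL
    omega
  obtain ⟨f, hf, hLf⟩ := L.exists_le_ker_of_lt_top hlt
  have hf' : f.toContinuousLinearMap ≠ 0 := by simpa using hf
  refine ⟨f.toContinuousLinearMap, hf', Submodule.eq_of_le_of_finrank_eq hLf ?_⟩
  have := finrank_ker_add_one hf'
  omega

/-- If a nonzero functional takes values in a cyclic group on the integer points, its kernel is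
a lattice subspace: the kernel of `∑ mⱼ xⱼ` is spanned by the vectors `mₖ eⱼ - mⱼ eₖ`, for any fixed
`k` with `mₖ ≠ 0`. -/
lemma isLatticeSubspace_ker {f : StrongDual ℝ 𝔼} (hf : f ≠ 0) {g : ℝ}
    (hg : ∀ z ∈ integerLattice n, ∃ m : ℤ, f z = m * g) : IsLatticeSubspace f.ker := by
  choose m hm using fun j => hg _ (single_mem_integerLattice j)
  have hfx : ∀ x : 𝔼, f x = ∑ j, x j * (m j * g) := by
    intro x
    conv_lhs => rw [← (EuclideanSpace.basisFun (Fin n) ℝ).sum_repr x]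
    simp [hm]
  obtain ⟨k, hk⟩ : ∃ k, f (EuclideanSpace.single k 1) ≠ 0 := by
    by_contra! h
    refine hf (ContinuousLinearMap.ext fun x => ?_)
    rw [hfx]
    simp [← hm, h]
  have hmk : (m k : ℝ) ≠ 0 := fun h => hk (by rw [hm, h, zero_mul])
  have hg0 : g ≠ 0 := fun h => hk (by rw [hm, h, mul_zero])
  rw [isLatticeSubspace_iff]
  intro x hx
  have hx0 : ∑ j, x j * m j = 0 := by
    have h1 : f x = 0 := hx
    rw [hfx] at h1
    simp_rw [← mul_assoc] at h1
    rw [← Finset.sum_mul] at h1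
    exact (mul_eq_zero.1 h1).resolve_right hg0
  have hsum : ∑ j, (x j / m k) • ((m k : ℝ) • EuclideanSpace.single j (1 : ℝ) -
      (m j : ℝ) • EuclideanSpace.single k (1 : ℝ)) = x := by
    simp_rw [smul_sub, smul_smul]
    rw [Finset.sum_sub_distrib, ← Finset.sum_smul]
    have h2 : ∑ j, x j / m k * m j = 0 := by
      simp_rw [div_mul_eq_mul_div]
      rw [← Finset.sum_div, hx0, zero_div]
    rw [h2, zero_smul, sub_zero]
    conv_rhs => rw [← (EuclideanSpace.basisFun (Fin n) ℝ).sum_repr x]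
    simp [div_mul_cancel₀ _ hmk]
  rw [← hsum]
  refine Submodule.sum_mem _ fun j _ => Submodule.smul_mem _ _ (Submodule.subset_span ⟨?_, ?_⟩)
  · simp only [SetLike.mem_coe, LinearMap.mem_ker, ContinuousLinearMap.coe_coe, map_sub, map_smul,
      hm, smul_eq_mul]
    ring
  · have h1 := (integerLattice n).zsmul_mem (single_mem_integerLattice j) (m k)
    have h2 := (integerLattice n).zsmul_mem (single_mem_integerLattice k) (m j)
    rw [Int.cast_smul_eq_zsmul, Int.cast_smul_eq_zsmul]
    exact (integerLattice n).sub_mem h1 h2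

/-- On the integer points, a functional whose kernel is not a lattice subspace takes values in
every nonempty open interval. -/
lemma exists_integer_apply_mem_Ioo {f : StrongDual ℝ 𝔼} (hf : f ≠ 0)
    (hL : ¬ IsLatticeSubspace f.ker) {a b : ℝ} (hab : a < b) :
    ∃ z ∈ integerLattice n, f z ∈ Set.Ioo a b := by
  rcases ((integerLattice n).map (f : 𝔼 →+ ℝ)).dense_or_cyclic with h | ⟨g, hg⟩
  · obtain ⟨_, ⟨z, hz, rfl⟩, hy⟩ := h.exists_mem_open isOpen_Ioo (Set.nonempty_Ioo.2 hab)
    exact ⟨z, hz, hy⟩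
  · refine absurd (isLatticeSubspace_ker hf (g := g) fun z hz => ?_) hL
    have h1 : f z ∈ (integerLattice n).map (f : 𝔼 →+ ℝ) := ⟨z, hz, rfl⟩
    rw [hg, AddSubgroup.mem_closure_singleton] at h1
    obtain ⟨m, hm⟩ := h1
    exact ⟨m, by simp [← hm]⟩

lemma vadd_ker_eq (f : StrongDual ℝ 𝔼) (a : 𝔼) :
    a +ᵥ (f.ker : Set 𝔼) = {x | f x = f a} := by
  ext x
  rw [Set.mem_vadd_set_iff_neg_vadd_mem]
  simp only [vadd_eq_add, SetLike.mem_coe, LinearMap.mem_ker, ContinuousLinearMap.coe_coe, map_add,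
    map_neg, neg_add_eq_zero, Set.mem_ofPred_eq]
  exact eq_comm

lemma isLatticeFree_setOf_apply_eq {f : StrongDual ℝ 𝔼} (hf : f ≠ 0) (b : ℝ) :
    IsLatticeFree {x : 𝔼 | f x = b} where
  isClosed := isClosed_eq f.continuous continuous_const
  convex := convex_setOf_apply_mem (convex_singleton b)
  interior_inter := by rw [interior_setOf_apply_eq hf, Set.empty_inter]

/-- A hyperplane that is not parallel to a lattice subspace is maximal lattice-free, since every
slab next to it contains integer points. -/
lemma isMaximalLatticeFree_hyperplane {f : StrongDual ℝ 𝔼} (hf : f ≠ 0)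
    (hL : ¬ IsLatticeSubspace f.ker) (b : ℝ) : IsMaximalLatticeFree {x : 𝔼 | f x = b} := by
  refine ⟨isLatticeFree_setOf_apply_eq hf b, fun K' hK' hKK' x hx => ?_⟩
  by_contra hxb
  have hxb : f x ≠ b := hxb
  -- replacing `f` and `b` by their negatives exchanges the two sides of the hyperplane
  wlog hlt : b < f x generalizing f b
  · have hneg : (-f).ker = f.ker := by
      ext v
      simp
    refine this (f := -f) (neg_ne_zero.2 hf) (hneg.symm ▸ hL) (-b) (fun y hy => hKK' ?_) ?_ ?_ ?_
    · exact neg_injective hy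
    · exact fun h => hxb (neg_injective h)
    · exact fun h => hxb (neg_injective h)
    · exact neg_lt_neg (lt_of_le_of_ne (not_lt.1 hlt) hxb)
  obtain ⟨z, hz, hzf⟩ := exists_integer_apply_mem_Ioo hf hL hlt
  refine hK'.notMem_interior hz (interior_maximal ?_ (isOpen_Ioo.preimage f.continuous) hzf)
  intro y hy
  have hy : b < f y ∧ f y < f x := hy
  have hpos : 0 < f x - b := by linarith
  set t := (f y - b) / (f x - b) with ht
  have ht1 : t < 1 := by rw [ht, div_lt_one hpos]; linarith
  have ht0 : 0 < t := div_pos (by linarith) hpos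
  have h1t : 1 - t ≠ 0 := by linarith
  -- `y` lies on the segment from a point of the hyperplane to `x`
  have hy' : (1 / (1 - t)) • (y - t • x) ∈ K' := hKK' (by
    change f _ = b
    rw [map_smul, map_sub, map_smul, smul_eq_mul, smul_eq_mul]
    have : t * (f x - b) = f y - b := by rw [ht]; field_simp
    field_simp
    linarith)
  have := hK'.convex hy' hx (sub_pos.2 ht1).le ht0.le (by ring)
  rwa [smul_smul, mul_one_div_cancel h1t, one_smul, sub_add_cancel] at this

/-- A proper lattice subspace is contained in the kernel of a nonzero functional that is integral on
the integer points: a determinant with all but one row filled by a basis of integer vectors. -/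
lemma IsLatticeSubspace.exists_integral_functional (hn : 1 ≤ n) {L : Submodule ℝ 𝔼}
    (hL : IsLatticeSubspace L) (hdim : Module.finrank ℝ L = n - 1) :
    ∃ g : StrongDual ℝ 𝔼, g ≠ 0 ∧ L ≤ g.ker ∧ ∀ z ∈ integerLattice n, ∃ m : ℤ, g z = m := by
  obtain ⟨k, rfl⟩ : ∃ k, n = k + 1 := ⟨n - 1, by omega⟩
  have hspan : Submodule.span ℝ ((L : Set (EuclideanSpace ℝ (Fin (k + 1)))) ∩
      integerPoints (k + 1)) = L :=
    Submodule.eq_of_le_of_finrank_eq (Submodule.span_le.2 Set.inter_subset_left) hL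
  have hv := Submodule.exists_fun_fin_finrank_span_eq ℝ
    ((L : Set (EuclideanSpace ℝ (Fin (k + 1)))) ∩ integerPoints (k + 1))
  have hk : Module.finrank ℝ (Submodule.span ℝ ((L : Set (EuclideanSpace ℝ (Fin (k + 1)))) ∩
      integerPoints (k + 1))) = k := by rw [hspan, hdim, Nat.add_sub_cancel]
  rw [hk, hspan] at hv
  obtain ⟨v, hvmem, hvspan, hvli⟩ := hv
  let e := (EuclideanSpace.basisFun (Fin (k + 1)) ℝ).toBasis
  let g : EuclideanSpace ℝ (Fin (k + 1)) →ₗ[ℝ] ℝ :=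
    e.det.toMultilinearMap.toLinearMap (Fin.cons 0 v) 0
  have hg : ∀ x, g x = e.det (Fin.cons x v : Fin (k + 1) → EuclideanSpace ℝ (Fin (k + 1))) := by
    intro x
    simp [g]
  refine ⟨g.toContinuousLinearMap, fun h0 => ?_, fun x hx => ?_, fun z hz => ?_⟩
  · obtain ⟨x, -, hx⟩ : ∃ x ∈ (⊤ : Submodule ℝ (EuclideanSpace ℝ (Fin (k + 1)))), x ∉ L := by
      refine SetLike.exists_of_lt (lt_top_iff_ne_top.2 fun h => ?_)
      rw [h, finrank_top, finrank_euclideanSpace_fin] at hdim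
      omega
    have hli := linearIndependent_finCons.2 ⟨hvli, hvspan.symm ▸ hx⟩
    have hu := (e.is_basis_iff_det).1 ⟨hli, hli.span_eq_top_of_card_eq_finrank (by simp)⟩
    refine hu.ne_zero ?_
    rw [← hg]
    exact congrArg (fun φ : StrongDual ℝ (EuclideanSpace ℝ (Fin (k + 1))) => φ x) h0
  · change g x = 0
    rw [hg]
    refine AlternatingMap.map_linearDependent _ _ fun hli => ?_
    exact (linearIndependent_finCons.1 hli).2 (hvspan.symm ▸ hx)
  · have hrow : ∀ i, (Fin.cons z v : Fin (k + 1) → EuclideanSpace ℝ (Fin (k + 1))) i ∈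
        integerPoints (k + 1) := fun i => by
      refine Fin.cases hz (fun i => ?_) i
      exact (hvmem i).2
    choose M hM using hrow
    refine ⟨(Matrix.of M).transpose.det, ?_⟩
    change g z = _
    rw [hg, Module.Basis.det_apply, Int.cast_det]
    congr 1
    ext i j
    simp [e, Module.Basis.toMatrix_apply, hM]

/-- A maximal lattice-free set without interior points is a hyperplane, and this hyperplane is not
parallel to a lattice subspace, because otherwise a split (the slab between two consecutive
integral level sets) would be larger. -/
lemma IsMaximalLatticeFree.exists_eq_vadd (hn : 1 ≤ n) {K : Set 𝔼} (hK : IsMaximalLatticeFree K)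
    (hi : ¬ (interior K).Nonempty) : ∃ (a : 𝔼) (L : Submodule ℝ 𝔼),
      Module.finrank ℝ L = n - 1 ∧ ¬ IsLatticeSubspace L ∧ K = a +ᵥ (L : Set 𝔼) := by
  have hn0 : vectorSpan ℝ K < ⊤ := by
    rw [lt_top_iff_ne_top]
    intro h
    refine hi (interior_nonempty_of_setDim_eq hn hK.prop.convex ?_)
    rw [setDim, h, finrank_top, finrank_euclideanSpace_fin]
  obtain ⟨f₀, hf₀, hKf₀⟩ := (vectorSpan ℝ K).exists_le_ker_of_lt_top hn0
  obtain ⟨f, hf, hKf⟩ : ∃ f : StrongDual ℝ 𝔼, f ≠ 0 ∧ vectorSpan ℝ K ≤ f.ker :=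
    ⟨f₀.toContinuousLinearMap, by simpa using hf₀, hKf₀⟩
  obtain ⟨a, ha⟩ : ∃ a, K ⊆ {x | f x = f a} := by
    rcases K.eq_empty_or_nonempty with h | ⟨a, ha⟩
    · exact ⟨0, by simp [h]⟩
    · refine ⟨a, fun x hx => ?_⟩
      have h1 : f (x - a) = 0 := hKf (vsub_mem_vectorSpan ℝ hx ha)
      rwa [map_sub, sub_eq_zero] at h1
  have hKeq : K = {x | f x = f a} :=
    Set.Subset.antisymm ha (hK.le_of_ge (isLatticeFree_setOf_apply_eq hf _) ha)
  have hdim : Module.finrank ℝ f.ker = n - 1 := by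
    have := finrank_ker_add_one hf
    omega
  refine ⟨a, f.ker, hdim, fun hL => ?_, by rw [hKeq, vadd_ker_eq]⟩
  obtain ⟨g, hg0, hg, hgZ⟩ := hL.exists_integral_functional hn hdim
  obtain ⟨c, hc⟩ := exists_eq_mul_of_ker_le hf fun x hx => hg hx
  -- the split containing `K`
  set S : Set 𝔼 := {x | g x ∈ Set.Icc (⌊g a⌋ : ℝ) (⌊g a⌋ + 1)} with hS
  have hSfree : IsLatticeFree S := by
    refine ⟨isClosed_Icc.preimage g.continuous, convex_setOf_apply_mem (convex_Icc _ _), ?_⟩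
    rw [Set.eq_empty_iff_forall_notMem]
    rintro z ⟨hz, hzZ⟩
    obtain ⟨m, hm⟩ := hgZ z hzZ
    have h1 := interior_setOf_apply_mem_Icc_subset hg0 _ _ hz
    rw [Set.mem_ofPred_eq, hm] at h1
    have h2 : ⌊g a⌋ < m := by exact_mod_cast h1.1
    have h3 : m < ⌊g a⌋ + 1 := by exact_mod_cast h1.2
    omega
  have hKS : K ⊆ S := by
    intro x hx
    have h1 : g x = g a := by rw [hc x, hc a, ha hx]
    rw [hS, Set.mem_ofPred_eq, h1]
    exact ⟨Int.floor_le _, (Int.lt_floor_add_one _).le⟩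
  have hSK : S ⊆ K := hK.le_of_ge hSfree hKS
  -- but the split has interior points
  obtain ⟨e, he⟩ : ∃ e, g e ≠ 0 := by
    by_contra! h
    exact hg0 (ContinuousLinearMap.ext h)
  refine hi ⟨(((⌊g a⌋ : ℝ) + 1 / 2) / g e) • e, interior_maximal (t := g ⁻¹' Set.Ioo _ _)
    (fun x hx => hSK (Set.Ioo_subset_Icc_self hx)) (isOpen_Ioo.preimage g.continuous) ?_⟩
  rw [Set.mem_preimage, map_smul, smul_eq_mul, div_mul_cancel₀ _ he]
  constructor <;> linarith

end IntegerPoints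

/-! ### The lineality space of a maximal lattice-free set -/

section Lineality

open Filter Topology

variable {n : ℕ}

local notation "𝔼" => EuclideanSpace ℝ (Fin n)

/-- The lineality space of a set `K`: the directions `v` such that `K` contains, with each of its
points, the whole line through that point of direction `v`. -/
def linealitySpace {E : Type*} [AddCommGroup E] [Module ℝ E] (K : Set E) : Submodule ℝ E where
  carrier := {v | ∀ x ∈ K, ∀ s : ℝ, x + s • v ∈ K}
  add_mem' := fun {v w} hv hw x hx s => by
    rw [smul_add, ← add_assoc]
    exact hw _ (hv x hx s) s
  zero_mem' := fun x hx s => by simpa using hx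
  smul_mem' := fun c v hv x hx s => by
    rw [smul_smul]
    exact hv x hx _

lemma add_mem_of_mem_linealitySpace {E : Type*} [AddCommGroup E] [Module ℝ E] {K : Set E} {x v : E}
    (hx : x ∈ K) (hv : v ∈ linealitySpace K) : x + v ∈ K := by
  simpa using hv x hx 1

/-- Pigeonhole principle: a bounded sequence has close terms with indices far apart. -/
lemma exists_norm_sub_lt_of_bounded {u : ℕ → 𝔼} {C : ℝ} (hu : ∀ k, ‖u k‖ ≤ C) {ε : ℝ}
    (hε : 0 < ε) (N : ℕ) : ∃ i j, i + N ≤ j ∧ ‖u j - u i‖ < ε := by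
  obtain ⟨a, -, φ, hφ, hlim⟩ := tendsto_subseq_of_bounded
    (Metric.isBounded_closedBall (x := (0 : 𝔼)) (r := C)) (x := u) (fun k => by simpa using hu k)
  obtain ⟨M, hM⟩ := Metric.cauchySeq_iff.1 hlim.cauchySeq ε hε
  refine ⟨φ M, φ (φ M + N + M), ?_, ?_⟩
  · have := hφ.le_apply (x := φ M + N + M)
    omega
  · rw [← dist_eq_norm]
    exact hM _ (by omega) _ le_rfl

lemma exists_integer_norm_sub_le (x : 𝔼) : ∃ z ∈ integerLattice n, ‖x - z‖ ≤ Real.sqrt n := by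
  refine ⟨WithLp.toLp 2 fun i => (⌊x i⌋ : ℝ), fun i => ⟨⌊x i⌋, rfl⟩, ?_⟩
  rw [EuclideanSpace.norm_eq]
  refine Real.sqrt_le_sqrt ?_
  calc ∑ i, ‖(x - WithLp.toLp 2 fun i => (⌊x i⌋ : ℝ)) i‖ ^ 2 ≤ ∑ _i : Fin n, (1 : ℝ) := by
        refine Finset.sum_le_sum fun i _ => ?_
        have h0 := Int.fract_nonneg (x i)
        have h1 := (Int.fract_lt_one (x i)).le
        have : (x - WithLp.toLp 2 fun i => (⌊x i⌋ : ℝ)) i = Int.fract (x i) := rfl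
        rw [this, Real.norm_of_nonneg h0]
        nlinarith
    _ = n := by simp

/-- Simultaneous approximation in the manner of Dirichlet: integer points come arbitrarily close to
arbitrarily large multiples of a given vector. -/
lemma exists_integer_near_nsmul (v : 𝔼) {ε : ℝ} (hε : 0 < ε) (N : ℕ) :
    ∃ q ∈ integerLattice n, ∃ m : ℕ, N ≤ m ∧ ‖q - (m : ℝ) • v‖ < ε := by
  choose z hz hzv using fun k : ℕ => exists_integer_norm_sub_le ((k : ℝ) • v)
  obtain ⟨i, j, hij, h⟩ := exists_norm_sub_lt_of_bounded hzv hε N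
  refine ⟨z j - z i, (integerLattice n).sub_mem (hz j) (hz i), j - i, by omega, ?_⟩
  have e : z j - z i - ((j - i : ℕ) : ℝ) • v =
      -(((j : ℝ) • v - z j) - ((i : ℝ) • v - z i)) := by
    rw [Nat.cast_sub (by omega)]
    module
  rw [e, norm_neg]
  exact h

/-- If every multiple `s • w` is, up to an arbitrarily small error, the sum of an integer point and
a direction in which `K` recedes, then `w` is a lineality direction of `K`, because the closure of
`K + ℝ w` is again lattice-free. -/
lemma IsMaximalLatticeFree.mem_linealitySpace {K : Set 𝔼} (hK : IsMaximalLatticeFree K)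
    (hi : (interior K).Nonempty) {w : 𝔼}
    (h : ∀ s ε : ℝ, 0 < ε → ∃ q ∈ integerLattice n, ∃ c, (∀ x ∈ K, x + c ∈ K) ∧
      ‖s • w - q - c‖ < ε) : w ∈ linealitySpace K := by
  set L : Submodule ℝ 𝔼 := Submodule.span ℝ {w} with hL
  have hconv : Convex ℝ (K + (L : Set 𝔼)) := hK.prop.convex.add L.convex
  have hsub : K ⊆ K + (L : Set 𝔼) := fun x hx => ⟨x, hx, 0, L.zero_mem, add_zero x⟩
  have hfree : IsLatticeFree (closure (K + (L : Set 𝔼))) := by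
    refine ⟨isClosed_closure, hconv.closure, ?_⟩
    rw [hconv.interior_closure_eq_interior_of_nonempty_interior (hi.mono (interior_mono hsub)),
      Set.eq_empty_iff_forall_notMem]
    rintro z ⟨hz, hzZ⟩
    obtain ⟨v, hv, hzv⟩ :=
      hK.prop.convex.exists_mem_interior_of_mem_interior_add_submodule hi L hz
    obtain ⟨s, rfl⟩ := Submodule.mem_span_singleton.1 hv
    obtain ⟨ε, hε, hball⟩ := Metric.isOpen_iff.1 isOpen_interior _ hzv
    obtain ⟨q, hq, c, hc, hqc⟩ := h s ε hε
    have h1 : z - q - c ∈ interior K := by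
      refine hball ?_
      have e : z - q - c - (z - s • w) = s • w - q - c := by abel
      rwa [Metric.mem_ball, dist_eq_norm, e]
    have h2 : (fun x => x - c) ⁻¹' interior K ⊆ interior K := by
      refine interior_maximal (fun x hx => ?_)
        (isOpen_interior.preimage (continuous_id.sub continuous_const))
      simpa using hc _ (interior_subset hx)
    exact hK.prop.notMem_interior ((integerLattice n).sub_mem hzZ hq) (h2 h1)
  have hle := hK.le_of_ge hfree (hsub.trans subset_closure)
  exact fun x hx s => hle (subset_closure
    ⟨x, hx, s • w, L.smul_mem _ (Submodule.mem_span_singleton_self w), rfl⟩)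

/-- The recession cone of a maximal lattice-free set with interior points is a linear space. -/
lemma IsMaximalLatticeFree.mem_linealitySpace_of_recession {K : Set 𝔼}
    (hK : IsMaximalLatticeFree K) (hi : (interior K).Nonempty) {v : 𝔼}
    (hv : ∀ x ∈ K, ∀ t : ℝ, 0 ≤ t → x + t • v ∈ K) : v ∈ linealitySpace K := by
  refine hK.mem_linealitySpace hi fun s ε hε => ?_
  obtain ⟨N, hN⟩ := exists_nat_ge (-s)
  obtain ⟨q, hq, m, hm, hqm⟩ := exists_integer_near_nsmul v hε N
  have hm' : (N : ℝ) ≤ m := by exact_mod_cast hm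
  refine ⟨-q, (integerLattice n).neg_mem hq, (s + m) • v, fun x hx => hv x hx _ (by linarith), ?_⟩
  have e : s • v - -q - (s + m) • v = q - (m : ℝ) • v := by module
  rwa [e]

lemma sub_starProjection_orthogonal_mem (L : Submodule ℝ 𝔼) (x : 𝔼) :
    x - Lᗮ.starProjection x ∈ L := by
  simp

lemma starProjection_orthogonal_eq_zero_iff {L : Submodule ℝ 𝔼} {x : 𝔼} :
    Lᗮ.starProjection x = 0 ↔ x ∈ L := by
  rw [Submodule.starProjection_apply_eq_zero_iff, Submodule.orthogonal_orthogonal]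

lemma starProjection_orthogonal_mem {K : Set 𝔼} {x : 𝔼} (hx : x ∈ K) :
    (linealitySpace K)ᗮ.starProjection x ∈ K := by
  have := add_mem_of_mem_linealitySpace hx
    (Submodule.neg_mem _ (sub_starProjection_orthogonal_mem (linealitySpace K) x))
  rwa [← sub_eq_add_neg, sub_sub_cancel] at this

/-- The section of `K` by the orthogonal complement of its lineality space is bounded. -/
lemma IsMaximalLatticeFree.isBounded_inter_orthogonal {K : Set 𝔼} (hK : IsMaximalLatticeFree K)
    (hi : (interior K).Nonempty) :
    Bornology.IsBounded (K ∩ ((linealitySpace K)ᗮ : Set 𝔼)) := by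
  set L := linealitySpace K
  by_contra hb
  obtain ⟨v, hv0, hv⟩ := not_bounded_iff_exists_ne_zero_mem_asymptoticCone.1 hb
  have hvL : v ∈ L := hK.mem_linealitySpace_of_recession hi fun x hx t ht => by
    rw [add_comm]
    exact hK.prop.convex.smul_vadd_mem_of_isClosed_of_mem_asymptoticCone hK.prop.isClosed ht
      (asymptoticCone_mono Set.inter_subset_left hv) hx
  have hvL' : v ∈ Lᗮ := by
    have := Lᗮ.convex.smul_vadd_mem_of_isClosed_of_mem_asymptoticCone (c := (1 : ℝ))
      Lᗮ.closed_of_finiteDimensional zero_le_one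
      (asymptoticCone_mono Set.inter_subset_right hv) Lᗮ.zero_mem
    simpa using this
  exact hv0 (inner_self_eq_zero (𝕜 := ℝ).1 (hvL' v hvL))

/-- Modulo the lineality space of a maximal lattice-free set, the integer points are discrete: a
limit direction of small projections would be a lineality direction. -/
lemma IsMaximalLatticeFree.exists_pos_forall_norm_starProjection {K : Set 𝔼}
    (hK : IsMaximalLatticeFree K) (hi : (interior K).Nonempty) :
    ∃ ε > 0, ∀ z ∈ integerLattice n, ‖(linealitySpace K)ᗮ.starProjection z‖ < ε →
      z ∈ linealitySpace K := by
  set L := linealitySpace K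
  set P := Lᗮ.starProjection
  by_contra! hcon
  choose z hz hzP hzL using fun k : ℕ => hcon (1 / ((k : ℝ) + 1)) (by positivity)
  have hP0 : ∀ k, 0 < ‖P (z k)‖ := fun k =>
    norm_pos_iff.2 fun h => hzL k (starProjection_orthogonal_eq_zero_iff.1 h)
  -- a limit `w` of the normalized projections
  set u : ℕ → 𝔼 := fun k => ‖P (z k)‖⁻¹ • P (z k) with hu
  obtain ⟨w, hw, φ, hφ, hlim⟩ := (isCompact_sphere (0 : 𝔼) 1).tendsto_subseq (x := u) fun k => by
    simp [hu, norm_smul, (hP0 k).ne']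
  have hwL' : w ∈ Lᗮ := Lᗮ.closed_of_finiteDimensional.mem_of_tendsto hlim
    (Eventually.of_forall fun k => Lᗮ.smul_mem _ (Lᗮ.starProjection_apply_mem _))
  have hwL : w ∈ L := by
    refine hK.mem_linealitySpace hi fun s ε hε => ?_
    have h1 : ∀ᶠ k in atTop, ‖s • (w - u (φ k))‖ < ε / 2 := by
      have h2 : Tendsto (fun k => ‖s • (w - u (φ k))‖) atTop (𝓝 0) := by
        simpa using ((tendsto_const_nhds (x := w)).sub hlim |>.const_smul s).norm
      exact h2.eventually (gt_mem_nhds (by positivity))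
    have h3 : ∀ᶠ k in atTop, ‖P (z (φ k))‖ < ε / 2 := by
      have h4 : Tendsto (fun k => 1 / (((φ k : ℕ) : ℝ) + 1)) atTop (𝓝 0) :=
        tendsto_one_div_add_atTop_nhds_zero_nat.comp hφ.tendsto_atTop
      filter_upwards [h4.eventually (gt_mem_nhds (by positivity : 0 < ε / 2))] with k hk
      exact (hzP _).trans hk
    obtain ⟨k, hk1, hk3⟩ := (h1.and h3).exists
    set y := z (φ k)
    have hy0 : 0 < ‖P y‖ := hP0 _
    set m : ℤ := round (s / ‖P y‖) with hm
    refine ⟨m • y, (integerLattice n).zsmul_mem (hz _) m, (m : ℝ) • (P y - y), fun x hx => ?_, ?_⟩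
    · refine add_mem_of_mem_linealitySpace hx (L.smul_mem _ ?_)
      rw [← neg_sub]
      exact L.neg_mem (sub_starProjection_orthogonal_mem L y)
    · have e : s • w - m • y - (m : ℝ) • (P y - y) =
          s • (w - u (φ k)) + (s / ‖P y‖ - m) • P y := by
        simp only [hu, ← Int.cast_smul_eq_zsmul ℝ]
        module
      rw [e]
      refine (norm_add_le _ _).trans_lt ?_
      have h5 : ‖(s / ‖P y‖ - m) • P y‖ ≤ 1 * ‖P y‖ := by
        rw [norm_smul, Real.norm_eq_abs]
        gcongr
        exact (abs_sub_round _).trans (by norm_num)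
      linarith
  have hw1 : ‖w‖ = 1 := by simpa using hw
  have : w = 0 := inner_self_eq_zero (𝕜 := ℝ).1 (hwL' w hwL)
  simp [this] at hw1

/-- The lineality space of a maximal lattice-free set with interior points is a lattice subspace:
integer points close to large multiples of `v ∈ L` lie in `L` by discreteness, so that `v` is a
limit of rescaled integer points of `L`. -/
lemma IsMaximalLatticeFree.isLatticeSubspace_linealitySpace {K : Set 𝔼}
    (hK : IsMaximalLatticeFree K) (hi : (interior K).Nonempty) :
    IsLatticeSubspace (linealitySpace K) := by
  set L := linealitySpace K
  obtain ⟨ε, hε, hL⟩ := hK.exists_pos_forall_norm_starProjection hi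
  rw [isLatticeSubspace_iff]
  intro v hv
  set L₀ := Submodule.span ℝ ((L : Set 𝔼) ∩ integerPoints n)
  have hclosed : IsClosed (L₀ : Set 𝔼) := L₀.closed_of_finiteDimensional
  change v ∈ (L₀ : Set 𝔼)
  rw [← hclosed.closure_eq, Metric.mem_closure_iff]
  intro δ hδ
  obtain ⟨q, hq, m, hm, hqm⟩ := exists_integer_near_nsmul v (lt_min hε hδ) 1
  have hm1 : (1 : ℝ) ≤ m := by exact_mod_cast hm
  have hqL : q ∈ L := by
    refine hL q hq (lt_of_le_of_lt ?_ (hqm.trans_le (min_le_left _ _)))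
    have h1 : Lᗮ.starProjection q = Lᗮ.starProjection (q - (m : ℝ) • v) := by
      rw [map_sub, map_smul, starProjection_orthogonal_eq_zero_iff.2 hv, smul_zero, sub_zero]
    rw [h1]
    exact Submodule.norm_starProjection_apply_le _ _
  refine ⟨(m : ℝ)⁻¹ • q, L₀.smul_mem _ (Submodule.subset_span ⟨hqL, hq⟩), ?_⟩
  have h2 : v - (m : ℝ)⁻¹ • q = (m : ℝ)⁻¹ • ((m : ℝ) • v - q) := by
    rw [smul_sub, smul_smul, inv_mul_cancel₀ (by positivity), one_smul]
  rw [dist_eq_norm, h2, norm_smul, norm_sub_rev, norm_inv, Real.norm_of_nonneg (by positivity)]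
  calc (m : ℝ)⁻¹ * ‖q - (m : ℝ) • v‖ ≤ 1 * ‖q - (m : ℝ) • v‖ := by
        gcongr
        exact inv_le_one_of_one_le₀ hm1
    _ < δ := by
        rw [one_mul]
        exact hqm.trans_le (min_le_right _ _)

/-- Modulo the lineality space, only finitely many integer points lie in a bounded region. -/
lemma IsMaximalLatticeFree.finite_starProjection_integerLattice {K : Set 𝔼}
    (hK : IsMaximalLatticeFree K) (hi : (interior K).Nonempty) (R : ℝ) :
    {y | ∃ z ∈ integerLattice n, (linealitySpace K)ᗮ.starProjection z = y ∧ ‖y‖ ≤ R}.Finite := by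
  set L := linealitySpace K
  obtain ⟨ε, hε, hL⟩ := hK.exists_pos_forall_norm_starProjection hi
  by_contra hinf
  have hinf : Set.Infinite _ := hinf
  set e := hinf.natEmbedding
  obtain ⟨i, j, hij, h⟩ := exists_norm_sub_lt_of_bounded (u := fun k => (e k : 𝔼)) (C := R)
    (fun k => (e k).2.choose_spec.2.2) hε 1
  obtain ⟨x, hx, hxi, -⟩ := (e i).2
  obtain ⟨y, hy, hyj, -⟩ := (e j).2
  rw [← hxi, ← hyj, ← map_sub] at h
  have h1 := hL _ ((integerLattice n).sub_mem hy hx) h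
  rw [← starProjection_orthogonal_eq_zero_iff, map_sub, hxi, hyj, sub_eq_zero] at h1
  have := e.injective (Subtype.ext h1)
  omega

end Lineality

/-! ### Polyhedrality and facets of maximal lattice-free sets -/

section Polyhedra

open Filter Topology

variable {n : ℕ}

local notation "𝔼" => EuclideanSpace ℝ (Fin n)

lemma isPolyhedron_setOf_forall_le {ι : Type*} [Finite ι] (f : ι → StrongDual ℝ 𝔼) (b : ι → ℝ) :
    IsPolyhedron {x | ∀ i, f i x ≤ b i} := by
  obtain ⟨m, ⟨e⟩⟩ := Finite.exists_equiv_fin ι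
  refine ⟨m, fun i => (InnerProductSpace.toDual ℝ 𝔼).symm (f (e.symm i)), fun i => b (e.symm i), ?_⟩
  ext x
  simp only [Set.mem_ofPred_eq, InnerProductSpace.toDual_symm_apply]
  exact (e.symm.forall_congr_right (q := fun i => f i x ≤ b i)).symm

lemma IsPolyhedron.inter {A B : Set 𝔼} (hA : IsPolyhedron A) (hB : IsPolyhedron B) :
    IsPolyhedron (A ∩ B) := by
  obtain ⟨k, a, b, rfl⟩ := hA
  obtain ⟨l, c, d, rfl⟩ := hB
  have := isPolyhedron_setOf_forall_le (Sum.elim (fun i => innerSL ℝ (a i))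
    (fun i => innerSL ℝ (c i))) (Sum.elim b d)
  simpa only [Sum.forall, Sum.elim_inl, Sum.elim_inr, Set.ofPred_and, innerSL_apply_apply] using this

/-- The preimage of a cube under a linear map is a polyhedron. -/
lemma isPolyhedron_setOf_abs_apply_le (T : 𝔼 →L[ℝ] 𝔼) (R : ℝ) :
    IsPolyhedron {x | ∀ j, |T x j| ≤ R} := by
  have h := isPolyhedron_setOf_forall_le
    (fun j : Fin n => (EuclideanSpace.proj j).comp T) (fun _ => R)
  have h' := isPolyhedron_setOf_forall_le
    (fun j : Fin n => -(EuclideanSpace.proj j).comp T) (fun _ => R)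
  convert h.inter h' using 1
  ext x
  have h1 : ∀ j, |T x j| ≤ R ↔ T x j ≤ R ∧ -T x j ≤ R := fun j => abs_le'
  simp only [Set.mem_ofPred_eq, h1, forall_and]
  rfl

/-- A functional that is bounded above on `K` vanishes on the lineality space of `K`. -/
lemma apply_eq_zero_of_mem_linealitySpace {K : Set 𝔼} (hne : K.Nonempty) {f : StrongDual ℝ 𝔼}
    {b : ℝ} (hf : ∀ x ∈ K, f x ≤ b) {v : 𝔼} (hv : v ∈ linealitySpace K) : f v = 0 := by
  obtain ⟨x, hx⟩ := hne
  by_contra h0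
  have h1 := hf _ (hv x hx ((b - f x + 1) / f v))
  rw [map_add, map_smul, smul_eq_mul, div_mul_cancel₀ _ h0] at h1
  linarith

lemma apply_starProjection_orthogonal {K : Set 𝔼} (hne : K.Nonempty) {f : StrongDual ℝ 𝔼}
    {b : ℝ} (hf : ∀ x ∈ K, f x ≤ b) (x : 𝔼) : f ((linealitySpace K)ᗮ.starProjection x) = f x := by
  have := apply_eq_zero_of_mem_linealitySpace hne hf (sub_starProjection_orthogonal_mem _ x)
  rw [map_sub] at this
  linarith

lemma IsMaximalLatticeFree.exists_norm_starProjection_le {K : Set 𝔼}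
    (hK : IsMaximalLatticeFree K) (hi : (interior K).Nonempty) :
    ∃ R, ∀ x ∈ K, ‖(linealitySpace K)ᗮ.starProjection x‖ ≤ R := by
  obtain ⟨R, hR⟩ := (hK.isBounded_inter_orthogonal hi).exists_norm_le
  exact ⟨R, fun x hx => hR _ ⟨starProjection_orthogonal_mem hx,
    Submodule.starProjection_apply_mem _ _⟩⟩

/-- A maximal lattice-free set with interior points is a polyhedron: the intersection of a box around
it (modulo its lineality space) with half-spaces separating it from the finitely many integer points
of the box is lattice-free. -/
lemma IsMaximalLatticeFree.isPolyhedron {K : Set 𝔼} (hK : IsMaximalLatticeFree K)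
    (hi : (interior K).Nonempty) : IsPolyhedron K := by
  set L := linealitySpace K
  set P := Lᗮ.starProjection with hP
  have hne : K.Nonempty := hi.mono interior_subset
  obtain ⟨R, hR⟩ := hK.exists_norm_starProjection_le hi
  set B : Set 𝔼 := {x | ∀ j, |P x j| ≤ R} with hB
  have hKB : K ⊆ B := fun x hx j => (PiLp.norm_apply_le (P x) j).trans (hR x hx)
  -- integer points of the box, modulo lineality
  set T : Set 𝔼 := {y | ∃ z ∈ integerLattice n, P z = y ∧ y ∈ B} with hT
  have hPP : ∀ x, P (P x) = P x := fun x =>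
    Submodule.starProjection_eq_self_iff.2 (Submodule.starProjection_apply_mem _ _)
  have hTfin : T.Finite := by
    refine (hK.finite_starProjection_integerLattice hi (Real.sqrt (n * R ^ 2))).subset ?_
    rintro y ⟨z, hz, hzy, hyB⟩
    refine ⟨z, hz, hzy, ?_⟩
    rw [EuclideanSpace.norm_eq]
    refine Real.sqrt_le_sqrt ?_
    calc ∑ j, ‖y j‖ ^ 2 ≤ ∑ _j : Fin n, R ^ 2 := by
          refine Finset.sum_le_sum fun j _ => ?_
          have h1 := hyB j
          rw [← hzy, hPP, hzy] at h1
          exact pow_le_pow_left₀ (norm_nonneg _) h1 2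
      _ = n * R ^ 2 := by simp
  have hsep : ∀ y : T, ∃ f : StrongDual ℝ 𝔼, f ≠ 0 ∧ ∀ x ∈ K, f x ≤ f y := by
    rintro ⟨y, z, hz, rfl, -⟩
    obtain ⟨f, hf0, hf⟩ :=
      hK.prop.convex.exists_forall_le_of_notMem_interior hi (hK.prop.notMem_interior hz)
    refine ⟨f, hf0, fun x hx => ?_⟩
    change f x ≤ f (P z)
    rw [hP, apply_starProjection_orthogonal hne hf]
    exact hf x hx
  choose f hf0 hf using hsep
  have := hTfin.to_subtype
  have hpoly : IsPolyhedron (B ∩ {x | ∀ y : T, f y x ≤ f y y}) :=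
    (isPolyhedron_setOf_abs_apply_le P R).inter (isPolyhedron_setOf_forall_le f _)
  have hsub : K ⊆ B ∩ {x | ∀ y : T, f y x ≤ f y y} := fun x hx => ⟨hKB hx, fun y => hf y x hx⟩
  have hfree : IsLatticeFree (B ∩ {x | ∀ y : T, f y x ≤ f y y}) := by
    refine ⟨hpoly.isClosed, hpoly.convex, Set.eq_empty_iff_forall_notMem.2 ?_⟩
    rintro z ⟨hz, hzZ⟩
    have hzB : P z ∈ B := fun j => by
      rw [hPP]
      exact (interior_subset hz).1 j
    set y : T := ⟨P z, z, hzZ, rfl, hzB⟩ with hy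
    refine hf0 y (eq_zero_of_mem_interior_of_forall_le hz fun x hx => ?_)
    have h1 : f y (P z) = f y z := apply_starProjection_orthogonal hne (hf y) z
    exact (hx.2 y).trans h1.le
  rw [Set.Subset.antisymm hsub (hK.le_of_ge hfree hsub)]
  exact hpoly

/-- The decomposition of a maximal lattice-free polyhedron as a polytope plus its lineality space. -/
lemma IsMaximalLatticeFree.exists_polytope_add {K : Set 𝔼} (hK : IsMaximalLatticeFree K)
    (hi : (interior K).Nonempty) : ∃ (r : ℕ) (Q : Set 𝔼) (L : Submodule ℝ 𝔼),
      r < n ∧ IsLatticeSubspace L ∧ Module.finrank ℝ L = r ∧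
        IsPolytope Q ∧ setDim Q = n - r ∧ K = Q + (L : Set 𝔼) := by
  set L := linealitySpace K with hL
  have hfin : Module.finrank ℝ L + Module.finrank ℝ Lᗮ = n := by
    rw [Submodule.finrank_add_finrank_orthogonal, finrank_euclideanSpace_fin]
  refine ⟨Module.finrank ℝ L, K ∩ (Lᗮ : Set 𝔼), L, ?_, hK.isLatticeSubspace_linealitySpace hi, rfl,
    ⟨(hK.isPolyhedron hi).inter ?_, hK.isBounded_inter_orthogonal hi⟩, ?_, ?_⟩
  · by_contra! hle
    -- otherwise `K` would be the whole space
    have htop : L = ⊤ := Submodule.eq_top_of_finrank_eq (by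
      rw [finrank_euclideanSpace_fin]
      omega)
    obtain ⟨x, hx⟩ := hi
    have huniv : K = Set.univ := Set.eq_univ_of_forall fun y => by
      have := add_mem_of_mem_linealitySpace (interior_subset hx)
        (show y - x ∈ linealitySpace K by rw [← hL, htop]; trivial)
      rwa [add_sub_cancel] at this
    refine hK.prop.notMem_interior (integerLattice n).zero_mem ?_
    rw [huniv, interior_univ]
    trivial
  · convert isPolyhedron_setOf_abs_apply_le L.starProjection 0 using 1
    ext x
    rw [SetLike.mem_coe, ← Submodule.starProjection_apply_eq_zero_iff]
    simp only [abs_nonpos_iff, Set.mem_ofPred_eq]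
    exact PiLp.ext_iff
  · suffices h : vectorSpan ℝ (K ∩ (Lᗮ : Set 𝔼)) = Lᗮ by
      rw [setDim, h]
      omega
    obtain ⟨y, hy⟩ := hi
    have hyK := interior_subset hy
    have hmem : ∀ w ∈ Lᗮ, y + w ∈ K → Lᗮ.starProjection y + w ∈ K ∩ (Lᗮ : Set 𝔼) := by
      intro w hw hyw
      have h1 := starProjection_orthogonal_mem hyw
      rw [map_add, Submodule.starProjection_eq_self_iff.2 hw] at h1
      exact ⟨h1, Lᗮ.add_mem (Submodule.starProjection_apply_mem _ _) hw⟩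
    apply le_antisymm
    · rw [vectorSpan_def, Submodule.span_le]
      rintro _ ⟨a, ha, b, hb, rfl⟩
      exact Lᗮ.sub_mem ha.2 hb.2
    · intro w hw
      have hc : Tendsto (fun s : ℝ => y + s • w) (𝓝[>] 0) (𝓝 y) := by
        have : Continuous fun s : ℝ => y + s • w := by fun_prop
        simpa using (this.tendsto 0).mono_left nhdsWithin_le_nhds
      obtain ⟨s, hsK, hs⟩ := ((hc.eventually (mem_interior_iff_mem_nhds.1 hy)).and
        self_mem_nhdsWithin).exists
      have hs : (0 : ℝ) < s := hs
      have h1 := vsub_mem_vectorSpan ℝ (hmem _ (Lᗮ.smul_mem s hw) hsK)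
        (hmem 0 Lᗮ.zero_mem (by simpa using hyK))
      rw [vsub_eq_sub, add_zero, add_sub_cancel_left] at h1
      exact (Submodule.smul_mem_iff _ hs.ne').1 h1
  · ext x
    constructor
    · intro hx
      exact ⟨Lᗮ.starProjection x, ⟨starProjection_orthogonal_mem hx,
        Submodule.starProjection_apply_mem _ _⟩, _, sub_starProjection_orthogonal_mem L x,
        add_sub_cancel _ _⟩
    · rintro ⟨q, hq, l, hl, rfl⟩
      exact add_mem_of_mem_linealitySpace hq.1 hl

/-- Every facet of a maximal lattice-free set with interior points has an integer point in its
relative interior: otherwise the inequality defining the facet could be relaxed slightly without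
introducing an integer point into the interior, because modulo lineality there are only finitely many
integer points nearby. -/
lemma IsMaximalLatticeFree.exists_integer_mem_intrinsicInterior {K F : Set 𝔼}
    (hK : IsMaximalLatticeFree K) (hi : (interior K).Nonempty) (hF : IsFacet K F) :
    (intrinsicInterior ℝ F ∩ integerPoints n).Nonempty := by
  set L := linealitySpace K with hL
  set P := Lᗮ.starProjection with hP
  have hne : K.Nonempty := hi.mono interior_subset
  obtain ⟨f, b, hf0, hfK, hFeq, hspan⟩ :=
    hF.exists_functional (setDim_eq_of_interior_nonempty hi)
  obtain ⟨R, hR⟩ := hK.exists_norm_starProjection_le hi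
  obtain ⟨m, a, c, hKeq⟩ := hK.isPolyhedron hi
  have hKac : ∀ x ∈ K, ∀ i, inner ℝ (a i) x ≤ c i := fun x hx => by rwa [hKeq] at hx
  have hFconv : Convex ℝ F := by
    rw [hFeq]
    exact hK.prop.convex.inter (convex_setOf_apply_mem (convex_singleton b))
  obtain ⟨p, hp⟩ := hF.nonempty.intrinsicInterior hFconv
  have hpF : p ∈ F := intrinsicInterior_subset hp
  have hpF' : p ∈ K ∧ f p = b := by rwa [hFeq] at hpF
  have hFK : F ⊆ K := fun x hx => by rw [hFeq] at hx; exact hx.1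
  obtain ⟨y, hy⟩ := hi
  have hyb : f y < b := by
    refine lt_of_le_of_ne (hfK y (interior_subset hy)) fun h =>
      hf0 (eq_zero_of_mem_interior_of_forall_le hy ?_)
    rw [h]
    exact hfK
  -- an inequality of the system that is tight at `p` follows from `f ≤ b`
  have htight : ∀ i, inner ℝ (a i) p = c i → ∀ x, f x ≤ b → inner ℝ (a i) x ≤ c i := by
    intro i hip x hx
    set g : StrongDual ℝ 𝔼 := innerSL ℝ (a i) with hg
    have hga : ∀ x, inner ℝ (a i) x = g x := fun x => rfl
    have hgF : ∀ x ∈ F, g x = g p := fun x hx =>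
      eq_of_mem_intrinsicInterior_of_forall_le hp
        (fun u hu => (hKac u (hFK hu) i).trans hip.ge) hx
    obtain ⟨k, hk⟩ := exists_eq_mul_of_ker_le hf0 (g := g) fun w hw => by
      have h1 : p + w ∈ affineSpan ℝ F := (hspan _).1 (by rw [map_add, hw, add_zero, hpF'.2])
      have h2 := AffineSubspace.vsub_mem_direction h1 (mem_affineSpan ℝ hpF)
      rw [direction_affineSpan, vsub_eq_sub, add_sub_cancel_left] at h2
      exact vectorSpan_le_ker hgF h2
    have h1 := hKac y (interior_subset hy) i
    rw [hga, ← hip, hga, hk, hk p, hpF'.2] at h1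
    have hk0 : 0 ≤ k := by
      by_contra! h
      nlinarith
    rw [← hip, hga, hga, hk, hk p, hpF'.2]
    exact mul_le_mul_of_nonneg_left hx hk0
  by_contra hnone
  -- a width `δ` such that no integer point of the box lies in the slab `b < f < b + δ`
  obtain ⟨δ, hδ, hδf⟩ : ∃ δ > 0, ∀ z ∈ integerLattice n, ‖P z‖ ≤ R + 1 → b < f z →
      b + δ ≤ f z := by
    have hfin := (hK.finite_starProjection_integerLattice ⟨y, hy⟩ (R + 1)).image f
    obtain ⟨ε, hε, hεf⟩ := Metric.isOpen_iff.1
      (hfin.subset Set.sdiff_subset : (_ \ {b} : Set ℝ).Finite).isClosed.isOpen_compl b (by simp)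
    refine ⟨ε, hε, fun z hz hzR hbz => ?_⟩
    by_contra! hlt
    have hball : f z ∈ Metric.ball b ε := by
      rw [Metric.mem_ball, Real.dist_eq, abs_of_pos (by linarith)]
      linarith
    exact hεf hball ⟨⟨P z, ⟨z, hz, rfl, hzR⟩, apply_starProjection_orthogonal hne hfK z⟩, hbz.ne'⟩
  -- the relaxed polyhedron, cut with a cylinder
  set C : Set 𝔼 := {x | ‖P x‖ ≤ R + 1} ∩ {x | ∀ i, inner ℝ (a i) p < c i → inner ℝ (a i) x ≤ c i}
    with hC
  set K' : Set 𝔼 := C ∩ {x | f x ≤ b + δ} with hK'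
  have hCK : ∀ x ∈ C, f x ≤ b → x ∈ K := by
    intro x hx hxb
    rw [hKeq]
    intro i
    rcases (hKac p hpF'.1 i).lt_or_eq with h | h
    · exact hx.2 i h
    · exact htight i h x hxb
  have hKK' : K ⊆ K' := fun x hx =>
    ⟨⟨(hR x hx).trans (by linarith), fun i _ => hKac x hx i⟩, (hfK x hx).trans (by linarith)⟩
  have hclosed : IsClosed K' := by
    refine ((isClosed_le (by fun_prop) continuous_const).inter ?_).inter
      (isClosed_le f.continuous continuous_const)
    simp only [Set.ofPred_forall]
    exact isClosed_iInter fun i => isClosed_iInter fun _ =>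
      isClosed_le (by fun_prop) continuous_const
  have hconvex : Convex ℝ K' := by
    refine (Convex.inter ?_ ?_).inter (convex_halfSpace_le f.toLinearMap.isLinear _)
    · have e : {x | ‖P x‖ ≤ R + 1} = P.toLinearMap ⁻¹' Metric.closedBall 0 (R + 1) :=
        Set.ext fun x => mem_closedBall_zero_iff.symm
      rw [e]
      exact (convex_closedBall (0 : 𝔼) (R + 1)).linear_preimage P.toLinearMap
    · simp only [Set.ofPred_forall]
      exact convex_iInter fun i => convex_iInter fun _ =>
        convex_halfSpace_le (innerSL ℝ (a i)).toLinearMap.isLinear (c i)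
  have hfree : IsLatticeFree K' := by
    refine ⟨hclosed, hconvex, Set.eq_empty_iff_forall_notMem.2 ?_⟩
    rintro z ⟨hz, hzZ⟩
    have hzK' := interior_subset hz
    have hzδ : f z < b + δ := by
      refine lt_of_le_of_ne hzK'.2 fun h => hf0 (eq_zero_of_mem_interior_of_forall_le hz ?_)
      rw [h]
      exact fun x hx => hx.2
    rcases lt_trichotomy (f z) b with h | h | h
    · refine hK.prop.notMem_interior hzZ (interior_maximal (t := interior K' ∩ {x | f x < b})
        (fun x hx => hCK x (interior_subset hx.1).1 (le_of_lt hx.2))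
        (isOpen_interior.inter (isOpen_lt f.continuous continuous_const)) ⟨hz, h⟩)
    · refine hnone ⟨z, mem_intrinsicInterior_of_isOpen isOpen_interior hz ((hspan z).1 h)
        fun x hx hxF => ?_, hzZ⟩
      rw [hFeq]
      have hxb := (hspan x).2 hxF
      exact ⟨hCK x (interior_subset hx).1 hxb.le, hxb⟩
    · exact absurd (hδf z hzZ hzK'.1.1 h) (not_le.2 hzδ)
  have hK'K : K' ⊆ K := hK.le_of_ge hfree hKK'
  -- yet `K'` contains points slightly beyond `p`
  have hc : Tendsto (fun s : ℝ => p + s • (p - y)) (𝓝[>] 0) (𝓝 p) := by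
    have : Continuous fun s : ℝ => p + s • (p - y) := by fun_prop
    simpa using (this.tendsto 0).mono_left nhdsWithin_le_nhds
  have hev : ∀ᶠ x in 𝓝 p, x ∈ K' := by
    have h1 : ∀ᶠ x in 𝓝 p, ‖P x‖ < R + 1 :=
      (P.continuous.norm.tendsto p).eventually_lt_const
        ((hR p hpF'.1).trans_lt (lt_add_one R))
    have h2 : ∀ᶠ x in 𝓝 p, ∀ i, inner ℝ (a i) p < c i → inner ℝ (a i) x < c i := by
      refine eventually_all.2 fun i => ?_
      by_cases hip : inner ℝ (a i) p < c i
      · have : Continuous fun x : 𝔼 => (inner ℝ (a i) x : ℝ) := by fun_prop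
        filter_upwards [(this.tendsto p).eventually_lt_const hip] with x hx _ using hx
      · exact Eventually.of_forall fun x h => absurd h hip
    have h3 : ∀ᶠ x in 𝓝 p, f x < b + δ :=
      (f.continuous.tendsto p).eventually_lt_const (by rw [hpF'.2]; linarith)
    filter_upwards [h1, h2, h3] with x hx1 hx2 hx3
    exact ⟨⟨hx1.le, fun i hi => (hx2 i hi).le⟩, hx3.le⟩
  obtain ⟨s, hsK, hs⟩ := ((hc.eventually hev).and self_mem_nhdsWithin).exists
  have hs : (0 : ℝ) < s := hs
  have h1 := hfK _ (hK'K hsK)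
  rw [map_add, map_smul, map_sub, smul_eq_mul, hpF'.2] at h1
  nlinarith

end Polyhedra

theorem mainTheorem1 (n : ℕ) (hn : 1 ≤ n) (K : Set (EuclideanSpace ℝ (Fin n))) :
    IsMaximalLatticeFree K ↔
      (∃ (a : EuclideanSpace ℝ (Fin n)) (L : Submodule ℝ (EuclideanSpace ℝ (Fin n))),
        Module.finrank ℝ L = n - 1 ∧ ¬ IsLatticeSubspace L ∧
          K = a +ᵥ (L : Set (EuclideanSpace ℝ (Fin n)))) ∨
      (IsPolyhedron K ∧ setDim K = n ∧ interior K ∩ integerPoints n = ∅ ∧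
        (∃ (r : ℕ) (Q : Set (EuclideanSpace ℝ (Fin n)))
          (L : Submodule ℝ (EuclideanSpace ℝ (Fin n))),
          r < n ∧ IsLatticeSubspace L ∧ Module.finrank ℝ L = r ∧
            IsPolytope Q ∧ setDim Q = n - r ∧
            K = Q + (L : Set (EuclideanSpace ℝ (Fin n)))) ∧
        ∀ F : Set (EuclideanSpace ℝ (Fin n)), IsFacet K F →
          (intrinsicInterior ℝ F ∩ integerPoints n).Nonempty) := by
  constructor
  · intro hK
    by_cases hi : (interior K).Nonempty
    · exact Or.inr ⟨hK.isPolyhedron hi, setDim_eq_of_interior_nonempty hi, hK.prop.interior_inter,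
        hK.exists_polytope_add hi, fun F hF => hK.exists_integer_mem_intrinsicInterior hi hF⟩
    · exact Or.inl (hK.exists_eq_vadd hn hi)
  · rintro (⟨a, L, hdim, hL, rfl⟩ | ⟨hpoly, hdim, hfree, -, hF⟩)
    · obtain ⟨f, hf, rfl⟩ := exists_eq_ker_of_finrank hn hdim
      rw [vadd_ker_eq]
      exact isMaximalLatticeFree_hyperplane hf hL _
    · exact hpoly.isMaximalLatticeFree (interior_nonempty_of_setDim_eq hn hpoly.convex hdim) hfree hF
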